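/- Let $\mathsf X=\mathsf X_u\times\mathsf X_n$ be a product of two finite sets, with elements $x=(x_u,x_n)$. Fix stochastic kernels $R_0(x,x_u')$ and $Q_0(x,x_n')$ ($x\in\mathsf X$, $x_u'\in\mathsf X_u$, $x_n'\in\mathsf X_n$) such that the nominal transition matrix $P_0(x,x')=R_0(x,x_u')Q_0(x,x_n')$ is irreducible and aperiodic, that is, there is $n_0\ge 1$ with $P_0^n(x,x')>0$ for all $n\ge n_0$ and all $x,x'$. Fix a function $\mathcal U\colon\mathsf X\to\mathbb R$ and a state $x^\circ\in\mathsf X$. *The decision problem.* For a stochastic kernel $R$ from $\mathsf X$ to $\mathsf X_u$ put $P(x,x')=R(x,x_u')Q_0(x,x_n')$. For $\zeta\in\mathbb R$ let $$\eta^*_\zeta=\max_{\pi,R}\bigl\{\zeta\,\pi(\mathcal U)-K(P\|P_0):\ \pi \text{ a pmf on } \mathsf X,\ \pi P=\pi\bigr\},\qquad K(P\|P_0)=\sum_{x,x'}\pi(x)P(x,x')\log\frac{P(x,x')}{P_0(x,x')},$$ where $\pi(\mathcal U)=\sum_x\pi(x)\mathcal U(x)$, and $K=\infty$ when $\pi(x)P(x,x')>0=P_0(x,x')$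 for some $x,x'$. The optimal transition matrix $\check P_\zeta$ is the maximizing $P$. A relative value function at $\zeta$ is a function $h^*_\zeta\colon\mathsf X\to\mathbb R$ with $h^*_\zeta(x^\circ)=0$ which, together with $\eta^*_\zeta$, solves the average reward optimality equation $$\max_R\Bigl\{w_\zeta(x,R)+\sum_{x'}P(x,x')h^*_\zeta(x')\Bigr\}=h^*_\zeta(x)+\eta^*_\zeta\quad(x\in\mathsf X),\qquad w_\zeta(x,R)=\zeta\,\mathcal U(x)-\sum_{x'}P(x,x')\log\frac{P(x,x')}{P_0(x,x')},$$ with $w_\zeta(x,R)=-\infty$ when $P(x,\cdot)$ is not absolutely continuous with respect to $P_0(x,\cdot)$. *The ODE.* For $h\colon\mathsf X\to\mathbb R$ let $$P_h(x,x')=P_0(x,x')\exp\bigl(h(x_u'\mid x)-\Lambda_h(x)\bigr),\quad h(x_u'\mid x)=\sum_{x_n'}Q_0(x,x_n')h(x_u',x_n'),\quad \Lambda_h(x)=\log\sum_{x'}P_0(x,x')e^{h(x_u'\mid x)}.$$ For an irreducible and aperiodic transition matrix $P$ with invariant pmf $\pi$ let $Z=[I-P+1\otimes\pi]^{-1}$,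 where every row of $1\otimes\pi$ equals $\pi$, and let $\mathcal H^\circ(P)$ be the function $H(x)=\sum_{x'}[Z(x,x')-Z(x^\circ,x')]\,\mathcal U(x')$. Put $\mathcal V(h)=\mathcal H^\circ(P_h)$ and consider the ODE $$\frac{d}{d\zeta}h^\circ_\zeta=\mathcal V(h^\circ_\zeta),\quad \zeta\in\mathbb R,\qquad h^\circ_0\equiv 0.$$ **Theorem.** The ODE has a solution $\{h^\circ_\zeta:\zeta\in\mathbb R\}$, with each $P_{h^\circ_\zeta}$ irreducible and aperiodic. For any such solution and every $\zeta\in\mathbb R$, $h^\circ_\zeta$ is the relative value function $h^*_\zeta$ (that is, it is a relative value function at $\zeta$, and the only one; in particular the solution is unique), and $\check P_\zeta=P_{h^\circ_\zeta}$ (that is, $P_{h^\circ_\zeta}$ is an optimal transition matrix at $\zeta$, and the only one). -/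

import Mathlib

namespace KLMDP

variable {Xu Xn : Type*} [Fintype Xu] [Fintype Xn]

/-- The nature/nurture transition matrix `P(x,x') = R(x,x_u') Q(x,x_n')` on `Xu × Xn`. -/
def transition (R : Xu × Xn → Xu → ℝ) (Q : Xu × Xn → Xn → ℝ) :
    Matrix (Xu × Xn) (Xu × Xn) ℝ :=
  fun x x' => R x x'.1 * Q x x'.2

/-- Irreducibility together with aperiodicity: all entries of `P ^ n` are positive for all
sufficiently large `n`. -/
def IsIrreducibleAperiodic {X : Type*} [Fintype X] [DecidableEq X] (P : Matrix X X ℝ) : Prop :=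
  ∃ n₀ : ℕ, 1 ≤ n₀ ∧ ∀ n, n₀ ≤ n → ∀ x x', 0 < (P ^ n) x x'

/-- `π` is an invariant probability mass function for `P`. -/
def IsInvariantPMF {X : Type*} [Fintype X] (P : Matrix X X ℝ) (π : X → ℝ) : Prop :=
  π ∈ stdSimplex ℝ X ∧ ∀ x', ∑ x, π x * P x x' = π x'

/-- The invariant pmf of `P` (used only for irreducible aperiodic transition matrices, where it
exists and is unique). -/
noncomputable def invariantPMF {X : Type*} [Fintype X] (P : Matrix X X ℝ) : X → ℝ :=
  Classical.epsilon (IsInvariantPMF P)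

/-- The fundamental matrix `Z = [I - P + 1 ⊗ π]⁻¹`, every row of `1 ⊗ π` being the invariant
pmf `π` of `P`. -/
noncomputable def fundamentalMatrix {X : Type*} [Fintype X] [DecidableEq X] (P : Matrix X X ℝ) :
    Matrix X X ℝ :=
  (1 - P + Matrix.of fun _ x' => invariantPMF P x')⁻¹

/-- `H(x) = ∑ x', [Z(x,x') - Z(x°,x')] 𝒰(x')`. -/
noncomputable def poissonSolution {X : Type*} [Fintype X] [DecidableEq X] (util : X → ℝ) (xo : X)
    (P : Matrix X X ℝ) : X → ℝ :=
  fun x => ∑ x', (fundamentalMatrix P x x' - fundamentalMatrix P xo x') * util x'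

open Classical in
/-- Kullback–Leibler divergence of pmfs on a finite set, equal to `∞` without absolute
continuity. -/
noncomputable def klDivergence {A : Type*} [Fintype A] (p q : A → ℝ) : EReal :=
  if ∀ a, q a = 0 → p a = 0 then ((∑ a, p a * Real.log (p a / q a) : ℝ) : EReal) else ⊤

open Classical in
/-- The Donsker–Varadhan rate function `K(P‖P₀) = ∑ π(x) P(x,x') log (P(x,x') / P₀(x,x'))`, for
an invariant pmf `π` of `P`; it is `∞` when `π(x) P(x,x')` is not absolutely continuous with
respect to `π(x) P₀(x,x')`. -/
noncomputable def rate {X : Type*} [Fintype X] (π : X → ℝ) (P P₀ : Matrix X X ℝ) : EReal :=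
  if ∀ x x', P₀ x x' = 0 → π x * P x x' = 0 then
    ((∑ x, ∑ x', π x * P x x' * Real.log (P x x' / P₀ x x') : ℝ) : EReal)
  else ⊤

/-- The data of the decision problem: the nominal control law `R₀`, the uncontrolled dynamics
`Q₀`, the utility `𝒰` and the reference state `x°`. -/
structure Model (Xu Xn : Type*) [Fintype Xu] [Fintype Xn] [DecidableEq Xu] [DecidableEq Xn] where
  R₀ : Xu × Xn → Xu → ℝ
  Q₀ : Xu × Xn → Xn → ℝ
  R₀_mem : ∀ x, R₀ x ∈ stdSimplex ℝ Xu
  Q₀_mem : ∀ x, Q₀ x ∈ stdSimplex ℝ Xn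
  irreducibleAperiodic : IsIrreducibleAperiodic (transition R₀ Q₀)
  util : Xu × Xn → ℝ
  xo : Xu × Xn

namespace Model

variable [DecidableEq Xu] [DecidableEq Xn] (M : Model Xu Xn)

/-- The nominal transition matrix `P₀`. -/
def P₀ : Matrix (Xu × Xn) (Xu × Xn) ℝ := transition M.R₀ M.Q₀

/-- `h(x_u' | x) = ∑ x_n', Q₀(x,x_n') h(x_u',x_n')`. -/
def cond (h : Xu × Xn → ℝ) (x : Xu × Xn) (xu' : Xu) : ℝ :=
  ∑ xn', M.Q₀ x xn' * h (xu', xn')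

/-- The normalization constant `Λ_h(x) = log ∑ x', P₀(x,x') exp (h(x_u' | x))`. -/
noncomputable def logMGF (h : Xu × Xn → ℝ) (x : Xu × Xn) : ℝ :=
  Real.log (∑ x', M.P₀ x x' * Real.exp (M.cond h x x'.1))

/-- `P_h(x,x') = P₀(x,x') exp (h(x_u' | x) - Λ_h(x))`. -/
noncomputable def tilted (h : Xu × Xn → ℝ) : Matrix (Xu × Xn) (Xu × Xn) ℝ :=
  fun x x' => M.P₀ x x' * Real.exp (M.cond h x x'.1 - M.logMGF h x)

/-- The vector field `𝒱(h)`. -/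
noncomputable def vectorField (h : Xu × Xn → ℝ) : Xu × Xn → ℝ :=
  poissonSolution M.util M.xo (M.tilted h)

/-- `h` solves `d/dζ h = 𝒱(h)` on all of `ℝ`, with `h₀ ≡ 0`, each `P_{h_ζ}` being in the domain of
irreducible aperiodic matrices. -/
def IsODESolution (h : ℝ → Xu × Xn → ℝ) : Prop :=
  h 0 = 0 ∧
    ∀ ζ, IsIrreducibleAperiodic (M.tilted (h ζ)) ∧ HasDerivAt h (M.vectorField (h ζ)) ζ

/-- `(π, R)` is feasible: `R` is a control law and `π` is an invariant pmf of the resulting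
transition matrix. -/
def Feasible (π : Xu × Xn → ℝ) (R : Xu × Xn → Xu → ℝ) : Prop :=
  (∀ x, R x ∈ stdSimplex ℝ Xu) ∧ IsInvariantPMF (transition R M.Q₀) π

/-- The average reward `ζ π(𝒰) - K(P‖P₀)`, where `P = R Q₀`. -/
noncomputable def averageReward (ζ : ℝ) (π : Xu × Xn → ℝ) (R : Xu × Xn → Xu → ℝ) : EReal :=
  ((ζ * ∑ x, π x * M.util x : ℝ) : EReal) - rate π (transition R M.Q₀) M.P₀

/-- `P` is an optimal transition matrix at `ζ`, that is, a maximizer of `ζ π(𝒰) - K(P‖P₀)` over the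
transition matrices of the form `R Q₀` and their invariant pmfs `π`. -/
def IsOptimalTransition (ζ : ℝ) (P : Matrix (Xu × Xn) (Xu × Xn) ℝ) : Prop :=
  ∃ π R, M.Feasible π R ∧ P = transition R M.Q₀ ∧
    ∀ π' R', M.Feasible π' R' → M.averageReward ζ π' R' ≤ M.averageReward ζ π R

/-- `η` is the optimal average reward at `ζ`. -/
def IsOptimalReward (ζ η : ℝ) : Prop :=
  IsGreatest {r : EReal | ∃ π R, M.Feasible π R ∧ r = M.averageReward ζ π R} (η : EReal)

/-- The one-step reward `w_ζ(x,R) = ζ 𝒰(x) - D(P(x,·)‖P₀(x,·))`, where `P = R Q₀`. -/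
noncomputable def reward (ζ : ℝ) (x : Xu × Xn) (R : Xu × Xn → Xu → ℝ) : EReal :=
  ((ζ * M.util x : ℝ) : EReal) - klDivergence (transition R M.Q₀ x) (M.P₀ x)

/-- The average reward optimality equation
`max_R {w_ζ(x,R) + ∑ x', P(x,x') h(x')} = h(x) + η` for all `x`. -/
def SolvesAROE (ζ : ℝ) (h : Xu × Xn → ℝ) (η : ℝ) : Prop :=
  ∀ x, IsGreatest
    {r : EReal | ∃ R : Xu × Xn → Xu → ℝ, (∀ y, R y ∈ stdSimplex ℝ Xu) ∧
      r = M.reward ζ x R + ((∑ x', transition R M.Q₀ x x' * h x' : ℝ) : EReal)}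
    ((h x + η : ℝ) : EReal)

/-- `h` is a relative value function at `ζ`: together with the optimal average reward it solves the
average reward optimality equation, and it is normalized by `h(x°) = 0`. -/
def IsRelativeValueFunction (ζ : ℝ) (h : Xu × Xn → ℝ) : Prop :=
  h M.xo = 0 ∧ ∃ η : ℝ, M.IsOptimalReward ζ η ∧ M.SolvesAROE ζ h η

end Model

end KLMDP

/-!
Evaluating the maximum in the average reward optimality equation by the Donsker-Varadhan identity
(`Model.sum_transition_mul_log`) turns it into `Λ_h(x) + ζ 𝒰(x) = h(x) + η` for all `x`
(`Model.solvesAROE_iff`). For `h` and `η` that satisfy this, the average reward of a feasible pair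
`(π, R)` is `η` minus the entropy rate of `R Q₀` relative to `P_h` (`Model.averageReward_eq`). Hence
`η` is the optimal reward and, since the invariant pmf of the irreducible matrix `P_h` charges every
state, `P_h` is the only optimal transition matrix (`Model.isOptimalTransition_iff`).

The gradient of `Λ` at `h` is `P_h`, so that differentiating the equation in `ζ` gives Poisson's
equation `h' - P_h h' = 𝒰 - η'`, whose solution normalized at `x°` is `𝒱(h)`. Read in one direction,
every solution of the differential equation keeps `Λ_h + ζ 𝒰 - h` constant in the state
(`Model.IsODESolution.aroe`). Read in the other, a differentiable family of solutions of the
optimality equation solves the differential equation (`Model.isODESolution_valueCurve`).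

Such a family is obtained without integrating the differential equation. With `k = h + η` the
optimality equation becomes `Ψ(k) = ζ 𝒰` for the map `Ψ(k) = k - Λ_k + k(x°)` (`Model.aroeMap`).
It is injective, by convexity of `Λ` and because superharmonic functions of an irreducible chain are
constant. Its derivative `I - P_k + 1 ⊗ δ_{x°}` is invertible. It is proper, because solutions are
bounded in terms of the right-hand side (`Model.exists_norm_le_mul_norm_aroeMap`). Its range is
thus open and closed, so `Ψ` is bijective with differentiable inverse.
-/

namespace KLMDP

open Matrix

/-! ### Irreducible stochastic matrices -/

section Chain

variable {X : Type*} [Fintype X] [DecidableEq X] {P : Matrix X X ℝ}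

lemma mem_rowStochastic_iff_mem_stdSimplex :
    P ∈ rowStochastic ℝ X ↔ ∀ x, P x ∈ stdSimplex ℝ X := by
  rw [mem_rowStochastic_iff_sum]
  exact ⟨fun h x => ⟨h.1 x, h.2 x⟩, fun h => ⟨fun x => (h x).1, fun x => (h x).2⟩⟩

lemma pow_mulVec_le_add (hP : P ∈ rowStochastic ℝ X) {d : X → ℝ} {c : ℝ}
    (h : ∀ x, (P *ᵥ d) x ≤ d x + c) (n : ℕ) (x : X) : ((P ^ n) *ᵥ d) x ≤ d x + n * c := by
  induction n generalizing x with
  | zero => simp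
  | succ n ih =>
    rw [pow_succ', ← mulVec_mulVec]
    calc (P *ᵥ (P ^ n *ᵥ d)) x ≤ ∑ y, P x y * (d y + n * c) :=
          Finset.sum_le_sum fun y _ => mul_le_mul_of_nonneg_left (ih y) (hP.1 x y)
      _ = (P *ᵥ d) x + n * c := by
          simp only [mul_add, Finset.sum_add_distrib, ← Finset.sum_mul,
            sum_row_of_mem_rowStochastic hP, one_mul]
          rfl
      _ ≤ d x + (n + 1 : ℕ) * c := by
          push_cast
          linarith [h x]

/-- An approximately superharmonic function of a stochastic matrix has oscillation of order `n * c`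
at the entries where `P ^ n` is positive: evaluate `P ^ n d ≤ d + n c` at the minimum of `d`. -/
lemma pow_apply_mul_sub_le (hP : P ∈ rowStochastic ℝ X) {d : X → ℝ} {c : ℝ}
    (h : ∀ x, (P *ᵥ d) x ≤ d x + c) {x₀ : X} (hx₀ : ∀ x, d x₀ ≤ d x) (n : ℕ) (y : X) :
    (P ^ n) x₀ y * (d y - d x₀) ≤ n * c := by
  have hPn : P ^ n ∈ rowStochastic ℝ X := pow_mem hP n
  have h1 := pow_mulVec_le_add hP h n x₀
  have h2 : ((P ^ n) *ᵥ d) x₀ = d x₀ + ∑ z, (P ^ n) x₀ z * (d z - d x₀) := by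
    simp only [mul_sub, Finset.sum_sub_distrib, ← Finset.sum_mul,
      sum_row_of_mem_rowStochastic hPn, one_mul, add_sub_cancel]
    rfl
  have h3 : (P ^ n) x₀ y * (d y - d x₀) ≤ ∑ z, (P ^ n) x₀ z * (d z - d x₀) :=
    Finset.single_le_sum (f := fun z => (P ^ n) x₀ z * (d z - d x₀))
      (fun z _ => mul_nonneg (hPn.1 _ _) (sub_nonneg.2 (hx₀ z))) (Finset.mem_univ y)
  linarith

lemma IsIrreducibleAperiodic.exists_pow_pos (hI : IsIrreducibleAperiodic P) :
    ∃ n : ℕ, ∀ x y, 0 < (P ^ n) x y :=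
  let ⟨n, _, h⟩ := hI
  ⟨n, h n le_rfl⟩

/-- Superharmonic functions of an irreducible stochastic matrix are constant. -/
lemma eq_of_superharmonic (hP : P ∈ rowStochastic ℝ X) (hI : IsIrreducibleAperiodic P)
    {d : X → ℝ} (h : ∀ x, (P *ᵥ d) x ≤ d x) (x y : X) : d x = d y := by
  obtain ⟨n, hn⟩ := hI.exists_pow_pos
  have : Nonempty X := ⟨x⟩
  obtain ⟨x₀, hx₀⟩ := Finite.exists_min d
  have key : ∀ z, d z = d x₀ := fun z => by
    have h1 := pow_apply_mul_sub_le hP (c := 0) (by simpa using h) hx₀ n z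
    have h2 := nonpos_of_mul_nonpos_right (by simpa using h1) (hn x₀ z)
    linarith [hx₀ z]
  exact (key x).trans (key y).symm

/-- The kernel of the Poisson equation: if `d - P d` is constant, then so is `d`. -/
lemma eq_of_sub_mulVec_eq_const (hP : P ∈ rowStochastic ℝ X) (hI : IsIrreducibleAperiodic P)
    {d : X → ℝ} {c : ℝ} (h : ∀ x, d x - (P *ᵥ d) x = c) (x y : X) : d x = d y := by
  rcases le_total 0 c with hc | hc
  · exact eq_of_superharmonic hP hI (fun z => by linarith [h z]) x y
  · refine neg_injective (eq_of_superharmonic hP hI (d := -d) (fun z => ?_) x y)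
    rw [mulVec_neg]
    simp only [Pi.neg_apply]
    linarith [h z]

/-- A stochastic matrix has an invariant pmf: `1 - P` is singular, hence has a left null vector
`ν`, and `|ν|` is again invariant, because `|ν| ≤ |ν| P` and both sides have the same total mass. -/
lemma exists_isInvariantPMF [Nonempty X] (hP : P ∈ rowStochastic ℝ X) :
    ∃ π, IsInvariantPMF P π := by
  have hdet : (1 - P).det = 0 := by
    rw [← exists_mulVec_eq_zero_iff]
    exact ⟨1, one_ne_zero, by rw [sub_mulVec, hP.2, one_mulVec, sub_self]⟩
  obtain ⟨ν, hν0, hν⟩ := exists_vecMul_eq_zero_iff.2 hdet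
  rw [vecMul_sub, vecMul_one, sub_eq_zero] at hν
  have hν' : ∀ y, ∑ x, ν x * P x y = ν y := fun y => (congrFun hν y).symm
  have hle : ∀ y ∈ Finset.univ, |ν y| ≤ ∑ x, |ν x| * P x y := fun y _ => by
    rw [← hν' y]
    refine (Finset.abs_sum_le_sum_abs _ _).trans_eq (Finset.sum_congr rfl fun x _ => ?_)
    rw [abs_mul, abs_of_nonneg (hP.1 x y)]
  have hsum : ∑ y, |ν y| = ∑ y, ∑ x, |ν x| * P x y := by
    rw [Finset.sum_comm]
    simp only [← Finset.mul_sum, sum_row_of_mem_rowStochastic hP, mul_one]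
  have heq := (Finset.sum_eq_sum_iff_of_le hle).1 hsum
  have hS : 0 < ∑ y, |ν y| := by
    obtain ⟨y, hy⟩ := Function.ne_iff.1 hν0
    exact Finset.sum_pos' (fun _ _ => abs_nonneg _) ⟨y, Finset.mem_univ y, abs_pos.2 hy⟩
  refine ⟨fun x => |ν x| / ∑ y, |ν y|, ⟨fun x => by positivity, ?_⟩, fun y => ?_⟩
  · rw [← Finset.sum_div, div_self hS.ne']
  · simp only [div_mul_eq_mul_div, ← Finset.sum_div]
    rw [← heq y (Finset.mem_univ y)]

lemma isInvariantPMF_invariantPMF [Nonempty X] (hP : P ∈ rowStochastic ℝ X) :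
    IsInvariantPMF P (invariantPMF P) :=
  Classical.epsilon_spec (exists_isInvariantPMF hP)

lemma IsInvariantPMF.vecMul_pow {π : X → ℝ} (hπ : IsInvariantPMF P π) (n : ℕ) :
    π ᵥ* (P ^ n) = π := by
  induction n with
  | zero => simp
  | succ n ih =>
    rw [pow_succ, ← vecMul_vecMul, ih]
    exact funext hπ.2

lemma IsInvariantPMF.pos {π : X → ℝ} (hπ : IsInvariantPMF P π) (hI : IsIrreducibleAperiodic P)
    (y : X) : 0 < π y := by
  obtain ⟨n, hn⟩ := hI.exists_pow_pos
  obtain ⟨x, hx⟩ : ∃ x, π x ≠ 0 := by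
    by_contra! h0
    simpa [h0] using hπ.1.2
  rw [← hπ.vecMul_pow n]
  exact Finset.sum_pos' (fun z _ => mul_nonneg (hπ.1.1 z) (hn z y).le)
    ⟨x, Finset.mem_univ x, mul_pos ((hπ.1.1 x).lt_of_ne' hx) (hn x y)⟩

lemma isUnit_det_fundamental [Nonempty X] (hP : P ∈ rowStochastic ℝ X)
    (hI : IsIrreducibleAperiodic P) :
    IsUnit (1 - P + Matrix.of fun _ x' => invariantPMF P x').det := by
  rw [isUnit_iff_ne_zero]
  intro hdet
  obtain ⟨v, hv0, hv⟩ := exists_mulVec_eq_zero_iff.2 hdet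
  have hπ := isInvariantPMF_invariantPMF hP
  have hv' : ∀ x, v x - (P *ᵥ v) x = -∑ y, invariantPMF P y * v y := fun x => by
    have := congrFun hv x
    rw [add_mulVec, sub_mulVec, one_mulVec] at this
    simp only [Pi.add_apply, Pi.sub_apply, mulVec, dotProduct, Pi.zero_apply, of_apply] at this ⊢
    linarith
  have hconst := eq_of_sub_mulVec_eq_const hP hI hv'
  refine hv0 (funext fun x => ?_)
  have h1 : (P *ᵥ v) x = v x := by
    simp only [mulVec, dotProduct, fun y => hconst y x, ← Finset.sum_mul,
      sum_row_of_mem_rowStochastic hP, one_mul]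
  have h2 : ∑ y, invariantPMF P y * v y = v x := by
    simp only [fun y => hconst y x, ← Finset.sum_mul, hπ.1.2, one_mul]
  have h3 := hv' x
  simp only [Pi.zero_apply]
  linarith

lemma poissonSolution_apply_self (util : X → ℝ) (xo : X) : poissonSolution util xo P xo = 0 := by
  simp [poissonSolution]

/-- `poissonSolution` solves Poisson's equation `(I - P) H = 𝒰 - const`. -/
lemma exists_poissonSolution_sub_mulVec (hP : P ∈ rowStochastic ℝ X)
    (hI : IsIrreducibleAperiodic P) (util : X → ℝ) (xo : X) :
    ∃ c, ∀ x, poissonSolution util xo P x - (P *ᵥ poissonSolution util xo P) x = util x - c := by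
  have : Nonempty X := ⟨xo⟩
  set y := fundamentalMatrix P *ᵥ util with hy
  have hH : poissonSolution util xo P = y - fun _ => y xo := by
    ext x
    simp only [poissonSolution, sub_mul, Finset.sum_sub_distrib]
    rfl
  have hmul : (1 - P + Matrix.of fun _ x' => invariantPMF P x') *ᵥ y = util := by
    rw [hy, mulVec_mulVec, fundamentalMatrix, mul_nonsing_inv _ (isUnit_det_fundamental hP hI),
      one_mulVec]
  refine ⟨∑ x', invariantPMF P x' * y x', fun x => ?_⟩
  have h1 := congrFun hmul x
  have h2 : (P *ᵥ fun _ => y xo) x = y xo := by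
    simp only [mulVec, dotProduct, ← Finset.sum_mul, sum_row_of_mem_rowStochastic hP, one_mul]
  rw [add_mulVec, sub_mulVec, one_mulVec] at h1
  rw [hH, mulVec_sub, Pi.sub_apply, Pi.sub_apply, h2, ← h1]
  simp only [Pi.add_apply, Pi.sub_apply, mulVec, dotProduct, of_apply]
  ring

lemma eq_poissonSolution (hP : P ∈ rowStochastic ℝ X) (hI : IsIrreducibleAperiodic P)
    {util : X → ℝ} {xo : X} {H : X → ℝ} (h0 : H xo = 0) {c : ℝ}
    (h : ∀ x, H x - (P *ᵥ H) x = util x - c) : H = poissonSolution util xo P := by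
  obtain ⟨c', hc'⟩ := exists_poissonSolution_sub_mulVec hP hI util xo
  ext x
  have := eq_of_sub_mulVec_eq_const hP hI (d := H - poissonSolution util xo P) (c := c' - c)
    (fun z => by rw [mulVec_sub, Pi.sub_apply, Pi.sub_apply]; linarith [h z, hc' z]) x xo
  rw [Pi.sub_apply, Pi.sub_apply, h0, poissonSolution_apply_self] at this
  linarith

/-- Irreducibility and aperiodicity only depend on a lower bound for the entries. -/
lemma IsIrreducibleAperiodic.of_mul_le {P' : Matrix X X ℝ} (hP : ∀ x y, 0 ≤ P x y)
    (hI : IsIrreducibleAperiodic P) {c : ℝ} (hc : 0 < c) (h : ∀ x y, c * P x y ≤ P' x y) :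
    IsIrreducibleAperiodic P' := by
  have hpow : ∀ n x y, 0 ≤ (P ^ n) x y ∧ c ^ n * (P ^ n) x y ≤ (P' ^ n) x y := by
    intro n
    induction n with
    | zero => intro x y; by_cases hxy : x = y <;> simp [one_apply, hxy]
    | succ n ih =>
      intro x y
      simp only [pow_succ, mul_apply]
      refine ⟨Finset.sum_nonneg fun z _ => mul_nonneg (ih x z).1 (hP z y), ?_⟩
      rw [Finset.mul_sum]
      refine Finset.sum_le_sum fun z _ => ?_
      calc c ^ n * c * ((P ^ n) x z * P z y) = (c ^ n * (P ^ n) x z) * (c * P z y) := by ring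
        _ ≤ _ := mul_le_mul (ih x z).2 (h z y) (mul_nonneg hc.le (hP z y))
            ((mul_nonneg (pow_nonneg hc.le n) (ih x z).1).trans (ih x z).2)
  obtain ⟨n₀, h1, hn⟩ := hI
  exact ⟨n₀, h1, fun n hle x y =>
    (mul_pos (pow_pos hc n) (hn n hle x y)).trans_le (hpow n x y).2⟩

end Chain

/-! ### Relative entropy and the tilted transition matrix -/

section Gibbs

variable {A : Type*} [Fintype A]

lemma mul_log_div_ge {p t : ℝ} (hp : 0 ≤ p) (ht : 0 ≤ t) (hac : t = 0 → p = 0) :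
    p - t ≤ p * Real.log (p / t) := by
  rcases ht.eq_or_lt with rfl | ht
  · simp [hac rfl]
  · have h := mul_nonneg ht.le (InformationTheory.klFun_nonneg (div_nonneg hp ht.le))
    rw [InformationTheory.klFun_apply] at h
    field_simp at h
    linarith

lemma eq_of_mul_log_div_eq {p t : ℝ} (hp : 0 ≤ p) (ht : 0 ≤ t) (hac : t = 0 → p = 0)
    (h : p - t = p * Real.log (p / t)) : p = t := by
  rcases ht.eq_or_lt with rfl | ht
  · exact hac rfl
  · have hd := div_nonneg hp ht.le
    rw [← div_eq_one_iff_eq ht.ne', ← InformationTheory.klFun_eq_zero_iff hd,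
      InformationTheory.klFun_apply]
    field_simp
    linarith

/-- Gibbs' inequality. -/
lemma sum_mul_log_div_nonneg {p t : A → ℝ} (hp : p ∈ stdSimplex ℝ A) (ht : t ∈ stdSimplex ℝ A)
    (hac : ∀ a, t a = 0 → p a = 0) : 0 ≤ ∑ a, p a * Real.log (p a / t a) := by
  have h := Finset.sum_le_sum fun a (_ : a ∈ Finset.univ) =>
    mul_log_div_ge (hp.1 a) (ht.1 a) (hac a)
  rwa [Finset.sum_sub_distrib, hp.2, ht.2, sub_self] at h

/-- The equality case of Gibbs' inequality. -/
lemma eq_of_sum_mul_log_div_eq_zero {p t : A → ℝ} (hp : p ∈ stdSimplex ℝ A)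
    (ht : t ∈ stdSimplex ℝ A) (hac : ∀ a, t a = 0 → p a = 0)
    (h : ∑ a, p a * Real.log (p a / t a) = 0) : p = t := by
  have h1 := (Finset.sum_eq_sum_iff_of_le fun a (_ : a ∈ Finset.univ) =>
    mul_log_div_ge (hp.1 a) (ht.1 a) (hac a)).1
    (by rw [Finset.sum_sub_distrib, hp.2, ht.2, sub_self, h])
  exact funext fun a =>
    eq_of_mul_log_div_eq (hp.1 a) (ht.1 a) (hac a) (h1 a (Finset.mem_univ a))

/-- Changing the reference measure from `q` to its exponential tilt by `f - Λ`. -/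
lemma sum_mul_log_div_tilt {p q : A → ℝ} (hp : p ∈ stdSimplex ℝ A)
    (hac : ∀ a, q a = 0 → p a = 0) (f : A → ℝ) (Λ : ℝ) :
    ∑ a, p a * Real.log (p a / q a) = ∑ a, p a * f a - Λ
      + ∑ a, p a * Real.log (p a / (q a * Real.exp (f a - Λ))) := by
  have h : ∀ a, p a * Real.log (p a / q a)
      = p a * f a - p a * Λ + p a * Real.log (p a / (q a * Real.exp (f a - Λ))) := fun a => by
    by_cases hpa : p a = 0
    · simp [hpa]
    · have hqa : q a ≠ 0 := fun hq => hpa (hac a hq)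
      rw [← div_div, Real.log_div (div_ne_zero hpa hqa) (Real.exp_ne_zero _), Real.log_exp]
      ring
  simp only [h, Finset.sum_add_distrib, Finset.sum_sub_distrib, ← Finset.sum_mul, hp.2, one_mul]

end Gibbs

variable {Xu Xn : Type*} [Fintype Xu] [Fintype Xn]

lemma transition_mem {R : Xu × Xn → Xu → ℝ} {Q : Xu × Xn → Xn → ℝ}
    (hR : ∀ x, R x ∈ stdSimplex ℝ Xu) (hQ : ∀ x, Q x ∈ stdSimplex ℝ Xn) (x : Xu × Xn) :
    transition R Q x ∈ stdSimplex ℝ (Xu × Xn) := by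
  refine ⟨fun x' => mul_nonneg ((hR x).1 _) ((hQ x).1 _), ?_⟩
  simp only [transition, Fintype.sum_prod_type, ← Finset.mul_sum, (hQ x).2, mul_one, (hR x).2]

namespace Model

variable [DecidableEq Xu] [DecidableEq Xn] (M : Model Xu Xn)

lemma sum_transition_mul_cond {R : Xu × Xn → Xu → ℝ} (h : Xu × Xn → ℝ) (x : Xu × Xn) :
    ∑ x', transition R M.Q₀ x x' * M.cond h x x'.1 = ∑ x', transition R M.Q₀ x x' * h x' := by
  simp only [transition, Fintype.sum_prod_type, cond]
  refine Finset.sum_congr rfl fun xu' _ => ?_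
  rw [← Finset.sum_mul, ← Finset.mul_sum, (M.Q₀_mem x).2, mul_one, Finset.mul_sum]
  exact Finset.sum_congr rfl fun xn' _ => by ring

lemma P₀_apply_mem (x : Xu × Xn) : M.P₀ x ∈ stdSimplex ℝ (Xu × Xn) :=
  transition_mem M.R₀_mem M.Q₀_mem x

lemma P₀_mem : M.P₀ ∈ rowStochastic ℝ (Xu × Xn) :=
  mem_rowStochastic_iff_mem_stdSimplex.2 M.P₀_apply_mem

lemma exp_logMGF (h : Xu × Xn → ℝ) (x : Xu × Xn) :
    Real.exp (M.logMGF h x) = ∑ x', M.P₀ x x' * Real.exp (M.cond h x x'.1) := by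
  refine Real.exp_log ?_
  obtain ⟨y, hy⟩ : ∃ y, M.P₀ x y ≠ 0 := by
    by_contra! h0
    simpa [h0] using (M.P₀_apply_mem x).2
  have hnn := (M.P₀_apply_mem x).1
  exact Finset.sum_pos' (fun z _ => mul_nonneg (hnn z) (Real.exp_pos _).le)
    ⟨y, Finset.mem_univ y, mul_pos ((hnn y).lt_of_ne' hy) (Real.exp_pos _)⟩

lemma tilted_apply_mem (h : Xu × Xn → ℝ) (x : Xu × Xn) :
    M.tilted h x ∈ stdSimplex ℝ (Xu × Xn) := by
  refine ⟨fun y => mul_nonneg ((M.P₀_apply_mem x).1 y) (Real.exp_pos _).le, ?_⟩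
  simp only [tilted, Real.exp_sub, ← mul_div_assoc, ← Finset.sum_div, ← M.exp_logMGF]
  exact div_self (Real.exp_ne_zero _)

lemma tilted_mem (h : Xu × Xn → ℝ) : M.tilted h ∈ rowStochastic ℝ (Xu × Xn) :=
  mem_rowStochastic_iff_mem_stdSimplex.2 (M.tilted_apply_mem h)

lemma tilted_isIrreducibleAperiodic (h : Xu × Xn → ℝ) : IsIrreducibleAperiodic (M.tilted h) := by
  have : Nonempty ((Xu × Xn) × (Xu × Xn)) := ⟨(M.xo, M.xo)⟩
  obtain ⟨z, hz⟩ := Finite.exists_min fun z : (Xu × Xn) × (Xu × Xn) =>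
    Real.exp (M.cond h z.1 z.2.1 - M.logMGF h z.1)
  refine M.irreducibleAperiodic.of_mul_le M.P₀_mem.1
    (Real.exp_pos (M.cond h z.1 z.2.1 - M.logMGF h z.1)) fun x y => ?_
  rw [mul_comm]
  exact mul_le_mul_of_nonneg_left (hz (x, y)) (M.P₀_mem.1 x y)

/-- The control law that gives the tilted transition matrix. -/
noncomputable def tiltedLaw (h : Xu × Xn → ℝ) (x : Xu × Xn) (xu' : Xu) : ℝ :=
  M.R₀ x xu' * Real.exp (M.cond h x xu' - M.logMGF h x)

lemma transition_tiltedLaw (h : Xu × Xn → ℝ) :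
    transition (M.tiltedLaw h) M.Q₀ = M.tilted h := by
  ext x x'
  simp only [transition, tiltedLaw, tilted, P₀]
  ring

lemma tiltedLaw_mem (h : Xu × Xn → ℝ) (x : Xu × Xn) : M.tiltedLaw h x ∈ stdSimplex ℝ Xu := by
  refine ⟨fun xu' => mul_nonneg ((M.R₀_mem x).1 _) (Real.exp_pos _).le, ?_⟩
  rw [← (M.tilted_apply_mem h x).2, ← transition_tiltedLaw]
  simp only [transition, Fintype.sum_prod_type, ← Finset.mul_sum, (M.Q₀_mem x).2, mul_one]

lemma sum_tilted_mul_cond (h g : Xu × Xn → ℝ) (x : Xu × Xn) :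
    ∑ x', M.tilted h x x' * M.cond g x x'.1 = (M.tilted h *ᵥ g) x := by
  rw [← transition_tiltedLaw, sum_transition_mul_cond]
  rfl

lemma cond_add_const (h : Xu × Xn → ℝ) (c : ℝ) (x : Xu × Xn) (xu' : Xu) :
    M.cond (fun y => h y + c) x xu' = M.cond h x xu' + c := by
  simp only [cond, mul_add, Finset.sum_add_distrib, ← Finset.sum_mul, (M.Q₀_mem x).2, one_mul]

lemma logMGF_add_const (h : Xu × Xn → ℝ) (c : ℝ) (x : Xu × Xn) :
    M.logMGF (fun y => h y + c) x = M.logMGF h x + c := by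
  apply Real.exp_injective
  rw [Real.exp_add, exp_logMGF, exp_logMGF]
  simp only [cond_add_const, Real.exp_add, Finset.sum_mul, mul_assoc]

lemma tilted_add_const (h : Xu × Xn → ℝ) (c : ℝ) : M.tilted (fun y => h y + c) = M.tilted h := by
  ext x x'
  simp only [tilted, cond_add_const, logMGF_add_const, add_sub_add_right_eq_sub]

lemma logMGF_zero (x : Xu × Xn) : M.logMGF 0 x = 0 := by
  simp [logMGF, cond, (M.P₀_apply_mem x).2]

lemma tilted_zero : M.tilted 0 = M.P₀ := by
  ext x x'
  simp [tilted, cond, logMGF_zero]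

lemma logMGF_mono {g h : Xu × Xn → ℝ} (hgh : ∀ y, g y ≤ h y) (x : Xu × Xn) :
    M.logMGF g x ≤ M.logMGF h x := by
  rw [← Real.exp_le_exp, exp_logMGF, exp_logMGF]
  refine Finset.sum_le_sum fun y _ => mul_le_mul_of_nonneg_left
    (Real.exp_le_exp.2 (Finset.sum_le_sum fun z _ => mul_le_mul_of_nonneg_left (hgh _)
      ((M.Q₀_mem x).1 z))) ((M.P₀_apply_mem x).1 y)

lemma logMGF_const (c : ℝ) (x : Xu × Xn) : M.logMGF (fun _ => c) x = c := by
  simpa [logMGF_zero] using M.logMGF_add_const 0 c x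

/-- Donsker-Varadhan identity: the entropy of an arbitrary transition law relative to the nominal
one, in terms of its entropy relative to the tilted one. -/
lemma sum_transition_mul_log {R : Xu × Xn → Xu → ℝ} (hR : ∀ x, R x ∈ stdSimplex ℝ Xu)
    (h : Xu × Xn → ℝ) {x : Xu × Xn} (hac : ∀ x', M.P₀ x x' = 0 → transition R M.Q₀ x x' = 0) :
    ∑ x', transition R M.Q₀ x x' * Real.log (transition R M.Q₀ x x' / M.P₀ x x')
      = ∑ x', transition R M.Q₀ x x' * h x' - M.logMGF h x
        + ∑ x', transition R M.Q₀ x x' *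
          Real.log (transition R M.Q₀ x x' / M.tilted h x x') := by
  rw [← M.sum_transition_mul_cond h]
  exact sum_mul_log_div_tilt (transition_mem hR M.Q₀_mem x) hac _ _

lemma tilted_eq_zero_iff {h : Xu × Xn → ℝ} {x x' : Xu × Xn} :
    M.tilted h x x' = 0 ↔ M.P₀ x x' = 0 := by
  simp [tilted, Real.exp_ne_zero]

/-- Convexity of `Λ`: the gradient of `Λ` at `h` is `P_h`. -/
lemma logMGF_add_tilted_mulVec_sub_le (g h : Xu × Xn → ℝ) (x : Xu × Xn) :
    M.logMGF h x + (M.tilted h *ᵥ (g - h)) x ≤ M.logMGF g x := by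
  have h1 := M.sum_transition_mul_log (M.tiltedLaw_mem h) g (x := x)
    (fun x' hx' => by rwa [transition_tiltedLaw, tilted_eq_zero_iff])
  have h2 := M.sum_transition_mul_log (M.tiltedLaw_mem h) h (x := x)
    (fun x' hx' => by rwa [transition_tiltedLaw, tilted_eq_zero_iff])
  rw [transition_tiltedLaw] at h1 h2
  have h3 := sum_mul_log_div_nonneg (M.tilted_apply_mem h x) (M.tilted_apply_mem g x)
    (fun x' hx' => by rwa [tilted_eq_zero_iff] at hx' ⊢)
  have h4 : ∑ x', M.tilted h x x' * Real.log (M.tilted h x x' / M.tilted h x x') = 0 :=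
    Finset.sum_eq_zero fun x' _ => by
      by_cases h0 : M.tilted h x x' = 0
      · simp [h0]
      · simp [div_self h0]
  rw [mulVec_sub, Pi.sub_apply]
  simp only [mulVec, dotProduct]
  linarith

/-! ### The optimality equation and optimal transition matrices -/

/-- The optimality equation with its maximum evaluated by the Donsker-Varadhan identity. -/
lemma solvesAROE_iff {ζ : ℝ} {h : Xu × Xn → ℝ} {η : ℝ} :
    M.SolvesAROE ζ h η ↔ ∀ x, M.logMGF h x + ζ * M.util x = h x + η := by
  refine forall_congr' fun x => ?_
  suffices hg : IsGreatest
      {r : EReal | ∃ R : Xu × Xn → Xu → ℝ, (∀ y, R y ∈ stdSimplex ℝ Xu) ∧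
        r = M.reward ζ x R + ((∑ x', transition R M.Q₀ x x' * h x' : ℝ) : EReal)}
      ((M.logMGF h x + ζ * M.util x : ℝ) : EReal) from
    ⟨fun H => EReal.coe_injective (hg.unique H), fun H => H ▸ hg⟩
  have hval : ∀ R : Xu × Xn → Xu → ℝ, (∀ y, R y ∈ stdSimplex ℝ Xu) →
      (∀ x', M.P₀ x x' = 0 → transition R M.Q₀ x x' = 0) →
      M.reward ζ x R + ((∑ x', transition R M.Q₀ x x' * h x' : ℝ) : EReal)
        = ((M.logMGF h x + ζ * M.util x - ∑ x', transition R M.Q₀ x x' *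
          Real.log (transition R M.Q₀ x x' / M.tilted h x x') : ℝ) : EReal) := by
    intro R hR hac
    rw [reward, klDivergence, if_pos hac, M.sum_transition_mul_log hR h hac, ← EReal.coe_sub,
      ← EReal.coe_add]
    congr 1
    ring
  constructor
  · refine ⟨M.tiltedLaw h, M.tiltedLaw_mem h, ?_⟩
    rw [hval _ (M.tiltedLaw_mem h)
      (fun x' hx' => by rwa [transition_tiltedLaw, tilted_eq_zero_iff]), transition_tiltedLaw,
      Finset.sum_eq_zero fun x' _ => ?_, sub_zero]
    by_cases h0 : M.tilted h x x' = 0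
    · simp [h0]
    · simp [div_self h0]
  · rintro r ⟨R, hR, rfl⟩
    by_cases hac : ∀ x', M.P₀ x x' = 0 → transition R M.Q₀ x x' = 0
    · rw [hval R hR hac, EReal.coe_le_coe_iff]
      have := sum_mul_log_div_nonneg (transition_mem hR M.Q₀_mem x) (M.tilted_apply_mem h x)
        (fun x' hx' => hac x' (M.tilted_eq_zero_iff.1 hx'))
      linarith
    · rw [reward, klDivergence, if_neg hac, EReal.sub_top, EReal.bot_add]
      exact bot_le

/-- Under the optimality equation, the loss of a policy against `η` is its entropy rate relative
to the tilted transition matrix. -/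
lemma averageReward_eq {ζ η : ℝ} {h : Xu × Xn → ℝ}
    (hη : ∀ x, M.logMGF h x + ζ * M.util x = h x + η) {π : Xu × Xn → ℝ}
    {R : Xu × Xn → Xu → ℝ} (hF : M.Feasible π R)
    (hac : ∀ x x', M.P₀ x x' = 0 → π x * transition R M.Q₀ x x' = 0) :
    M.averageReward ζ π R = ((η - ∑ x, π x * ∑ x', transition R M.Q₀ x x' *
      Real.log (transition R M.Q₀ x x' / M.tilted h x x') : ℝ) : EReal) := by
  obtain ⟨hR, hπ, hinv⟩ := hF
  rw [averageReward, rate, if_pos hac, ← EReal.coe_sub]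
  congr 1
  set D : Xu × Xn → ℝ := fun x => ∑ x', transition R M.Q₀ x x' *
      Real.log (transition R M.Q₀ x x' / M.tilted h x x') with hD
  have h1 : ∀ x, ∑ x', π x * transition R M.Q₀ x x'
        * Real.log (transition R M.Q₀ x x' / M.P₀ x x')
      = ∑ x', π x * transition R M.Q₀ x x' * h x' - π x * h x - π x * η
        + ζ * (π x * M.util x) + π x * D x := by
    intro x
    by_cases h0 : π x = 0
    · simp [h0]
    · have h2 := M.sum_transition_mul_log hR h (x := x)
        fun x' hx' => (mul_eq_zero.1 (hac x x' hx')).resolve_left h0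
      simp only [mul_assoc, ← Finset.mul_sum]
      rw [h2, eq_sub_of_add_eq (hη x)]
      ring
  have h3 : ∑ x, ∑ x', π x * transition R M.Q₀ x x' * h x' = ∑ x, π x * h x := by
    rw [Finset.sum_comm]
    simp only [← Finset.sum_mul, hinv]
  simp only [h1, Finset.sum_add_distrib, Finset.sum_sub_distrib, h3, ← Finset.mul_sum,
    ← Finset.sum_mul, hπ.2, one_mul]
  ring

/-- The entropy rate relative to `P_h` is nonnegative and, because `P_h` is irreducible, vanishes
only for the transition matrix `P_h` itself. -/
lemma averageReward_le {ζ η : ℝ} {h : Xu × Xn → ℝ}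
    (hη : ∀ x, M.logMGF h x + ζ * M.util x = h x + η) {π : Xu × Xn → ℝ}
    {R : Xu × Xn → Xu → ℝ} (hF : M.Feasible π R) :
    M.averageReward ζ π R ≤ (η : EReal) ∧
      (M.averageReward ζ π R = (η : EReal) → transition R M.Q₀ = M.tilted h) := by
  by_cases hac : ∀ x x', M.P₀ x x' = 0 → π x * transition R M.Q₀ x x' = 0
  swap
  · rw [averageReward, rate, if_neg hac, EReal.sub_top]
    exact ⟨bot_le, fun h0 => absurd h0 (EReal.bot_ne_coe _)⟩
  rw [M.averageReward_eq hη hF hac, EReal.coe_le_coe_iff, EReal.coe_eq_coe_iff]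
  obtain ⟨hR, hinv⟩ := hF
  have hac' : ∀ x, π x ≠ 0 → ∀ x', M.tilted h x x' = 0 → transition R M.Q₀ x x' = 0 :=
    fun x hx x' hx' => (mul_eq_zero.1 (hac x x' (M.tilted_eq_zero_iff.1 hx'))).resolve_left hx
  have hnn : ∀ x ∈ Finset.univ, 0 ≤ π x * ∑ x', transition R M.Q₀ x x' *
      Real.log (transition R M.Q₀ x x' / M.tilted h x x') := by
    intro x _
    by_cases hx : π x = 0
    · simp [hx]
    · exact mul_nonneg (hinv.1.1 x) (sum_mul_log_div_nonneg (transition_mem hR M.Q₀_mem x)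
        (M.tilted_apply_mem h x) (hac' x hx))
  refine ⟨by linarith [Finset.sum_nonneg hnn], fun heq => ?_⟩
  have hrow : ∀ x, π x ≠ 0 → transition R M.Q₀ x = M.tilted h x := by
    intro x hx
    have h0 := (Finset.sum_eq_zero_iff_of_nonneg hnn).1 (by linarith) x (Finset.mem_univ x)
    exact eq_of_sum_mul_log_div_eq_zero (transition_mem hR M.Q₀_mem x) (M.tilted_apply_mem h x)
      (hac' x hx) ((mul_eq_zero.1 h0).resolve_left hx)
  -- `π` is therefore invariant for the irreducible matrix `P_h`, so that it charges every state.
  have hinv' : IsInvariantPMF (M.tilted h) π := by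
    refine ⟨hinv.1, fun x' => ?_⟩
    rw [← hinv.2 x']
    refine Finset.sum_congr rfl fun x _ => ?_
    by_cases hx : π x = 0
    · simp [hx]
    · rw [hrow x hx]
  exact funext fun x => hrow x (hinv'.pos (M.tilted_isIrreducibleAperiodic h) x).ne'

lemma exists_averageReward_eq {ζ η : ℝ} {h : Xu × Xn → ℝ}
    (hη : ∀ x, M.logMGF h x + ζ * M.util x = h x + η) :
    ∃ π, M.Feasible π (M.tiltedLaw h) ∧ M.averageReward ζ π (M.tiltedLaw h) = (η : EReal) := by
  have : Nonempty (Xu × Xn) := ⟨M.xo⟩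
  obtain ⟨π, hπ⟩ := exists_isInvariantPMF (M.tilted_mem h)
  have hF : M.Feasible π (M.tiltedLaw h) :=
    ⟨M.tiltedLaw_mem h, by rwa [transition_tiltedLaw]⟩
  refine ⟨π, hF, ?_⟩
  rw [M.averageReward_eq hη hF fun x x' h0 => by
    rw [transition_tiltedLaw, M.tilted_eq_zero_iff.2 h0, mul_zero], transition_tiltedLaw,
    Finset.sum_eq_zero fun x _ => ?_, sub_zero]
  rw [Finset.sum_eq_zero fun x' _ => ?_, mul_zero]
  by_cases h0 : M.tilted h x x' = 0
  · simp [h0]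
  · simp [div_self h0]

lemma isOptimalReward {ζ η : ℝ} {h : Xu × Xn → ℝ}
    (hη : ∀ x, M.logMGF h x + ζ * M.util x = h x + η) : M.IsOptimalReward ζ η := by
  obtain ⟨π, hF, hr⟩ := M.exists_averageReward_eq hη
  refine ⟨⟨π, M.tiltedLaw h, hF, hr.symm⟩, ?_⟩
  rintro r ⟨π', R', hF', rfl⟩
  exact (M.averageReward_le hη hF').1

lemma isOptimalTransition_iff {ζ η : ℝ} {h : Xu × Xn → ℝ}
    (hη : ∀ x, M.logMGF h x + ζ * M.util x = h x + η) (P : Matrix (Xu × Xn) (Xu × Xn) ℝ) :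
    M.IsOptimalTransition ζ P ↔ P = M.tilted h := by
  obtain ⟨π, hF, hr⟩ := M.exists_averageReward_eq hη
  constructor
  · rintro ⟨π', R', hF', rfl, hopt⟩
    have hle := M.averageReward_le hη hF'
    exact hle.2 (hle.1.antisymm (hr ▸ hopt π _ hF))
  · rintro rfl
    refine ⟨π, M.tiltedLaw h, hF, (M.transition_tiltedLaw h).symm, fun π' R' hF' => ?_⟩
    rw [hr]
    exact (M.averageReward_le hη hF').1

/-! ### Global invertibility of the optimality equation -/

lemma hasStrictFDerivAt_logMGF (h : Xu × Xn → ℝ) :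
    HasStrictFDerivAt M.logMGF (LinearMap.toContinuousLinearMap (M.tilted h).mulVecLin) h := by
  rw [hasStrictFDerivAt_pi']
  intro x
  have hcond : ∀ xu', HasStrictFDerivAt (fun g : Xu × Xn → ℝ => M.cond g x xu')
      (∑ xn', M.Q₀ x xn' • ContinuousLinearMap.proj (R := ℝ) (φ := fun _ => ℝ) (xu', xn')) h :=
    fun xu' => HasStrictFDerivAt.fun_sum fun xn' _ =>
      (hasStrictFDerivAt_apply (𝕜 := ℝ) (F' := fun _ => ℝ) (xu', xn') h).const_mul _
  have hsum := HasStrictFDerivAt.fun_sum (u := Finset.univ) fun (x' : Xu × Xn) _ =>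
    ((hcond x'.1).exp.const_mul (M.P₀ x x'))
  have hlog := hsum.log (by rw [← M.exp_logMGF]; exact Real.exp_ne_zero _)
  refine hlog.congr_fderiv (ContinuousLinearMap.ext fun v => ?_)
  rw [← M.exp_logMGF]
  have : (M.tilted h *ᵥ v) x = ∑ x', M.tilted h x x' * M.cond v x x'.1 :=
    (M.sum_tilted_mul_cond h v x).symm
  simp only [_root_.smul_apply, _root_.sum_apply,
    ContinuousLinearMap.proj_apply, smul_eq_mul, ContinuousLinearMap.comp_apply,
    LinearMap.coe_toContinuousLinearMap', mulVecLin_apply, this, Finset.mul_sum]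
  refine Finset.sum_congr rfl fun x' _ => ?_
  simp only [tilted, cond, Real.exp_sub, Finset.mul_sum]
  exact Finset.sum_congr rfl fun xn' _ => by field_simp

/-- The optimality equation as a map: `k = h + η` with `h(x°) = 0` solves
`Λ_h + ζ 𝒰 = h + η` if and only if `aroeMap k = ζ 𝒰`, because `η = k(x°)` and
`Λ_h = Λ_k - k(x°)`. -/
noncomputable def aroeMap (k : Xu × Xn → ℝ) : Xu × Xn → ℝ :=
  fun x => k x - M.logMGF k x + k M.xo

lemma aroeMap_add_const {ζ η : ℝ} {h : Xu × Xn → ℝ} (h0 : h M.xo = 0)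
    (hη : ∀ x, M.logMGF h x + ζ * M.util x = h x + η) :
    M.aroeMap (fun y => h y + η) = ζ • M.util := by
  ext x
  simp only [aroeMap, logMGF_add_const, h0, Pi.smul_apply, smul_eq_mul]
  linarith [hη x]

/-- The convexity of `Λ` makes the difference of two preimages superharmonic. -/
lemma aroeMap_injective : Function.Injective M.aroeMap := by
  have key : ∀ k l : Xu × Xn → ℝ, M.aroeMap k = M.aroeMap l → k M.xo ≤ l M.xo → k = l := by
    intro k l hkl hle
    have h1 : ∀ x, k x - M.logMGF k x + k M.xo = l x - M.logMGF l x + l M.xo := congrFun hkl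
    have hconst := eq_of_superharmonic (M.tilted_mem l) (M.tilted_isIrreducibleAperiodic l)
      (d := k - l) fun x => by
        have := M.logMGF_add_tilted_mulVec_sub_le k l x
        rw [Pi.sub_apply]
        linarith [h1 x]
    have hk : k = fun y => l y + (k M.xo - l M.xo) := by
      ext y
      have := hconst y M.xo
      simp only [Pi.sub_apply] at this
      linarith
    have h2 : M.logMGF k M.xo = M.logMGF l M.xo + (k M.xo - l M.xo) := by
      conv_lhs => rw [hk]
      exact M.logMGF_add_const _ _ _
    have h3 : k M.xo - l M.xo = 0 := by linarith [h1 M.xo]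
    rw [hk, h3]
    simp
  intro k l hkl
  rcases le_total (k M.xo) (l M.xo) with h | h
  · exact key k l hkl h
  · exact (key l k hkl.symm h).symm

/-- The derivative of `aroeMap` at `k`, namely `I - P_k + 1 ⊗ δ_{x°}`. -/
noncomputable def aroeDeriv (k : Xu × Xn → ℝ) : (Xu × Xn → ℝ) →L[ℝ] (Xu × Xn → ℝ) :=
  ContinuousLinearMap.id ℝ _ - LinearMap.toContinuousLinearMap (M.tilted k).mulVecLin
    + ContinuousLinearMap.pi fun _ => ContinuousLinearMap.proj M.xo

lemma aroeDeriv_apply (k v : Xu × Xn → ℝ) (x : Xu × Xn) :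
    M.aroeDeriv k v x = v x - (M.tilted k *ᵥ v) x + v M.xo := rfl

lemma hasStrictFDerivAt_aroeMap (k : Xu × Xn → ℝ) :
    HasStrictFDerivAt M.aroeMap (M.aroeDeriv k) k := by
  have h1 : HasStrictFDerivAt (fun k : Xu × Xn → ℝ => fun _ : Xu × Xn => k M.xo)
      (ContinuousLinearMap.pi fun _ => ContinuousLinearMap.proj (R := ℝ) M.xo) k :=
    (ContinuousLinearMap.pi fun _ : Xu × Xn =>
      ContinuousLinearMap.proj (R := ℝ) (φ := fun _ => ℝ) M.xo).hasStrictFDerivAt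
  exact ((hasStrictFDerivAt_id k).sub (M.hasStrictFDerivAt_logMGF k)).add h1

lemma aroeDeriv_injective (k : Xu × Xn → ℝ) : Function.Injective (M.aroeDeriv k) := by
  rw [injective_iff_map_eq_zero]
  intro v hv
  have h1 : ∀ x, v x - (M.tilted k *ᵥ v) x = -v M.xo := fun x => by
    have := congrFun hv x
    rw [aroeDeriv_apply, Pi.zero_apply] at this
    linarith
  have hconst := eq_of_sub_mulVec_eq_const (M.tilted_mem k)
    (M.tilted_isIrreducibleAperiodic k) h1
  have h2 : (M.tilted k *ᵥ v) M.xo = v M.xo := by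
    simp only [mulVec, dotProduct, fun y => hconst y M.xo, ← Finset.sum_mul,
      sum_row_of_mem_rowStochastic (M.tilted_mem k), one_mul]
  ext x
  rw [hconst x M.xo, Pi.zero_apply]
  linarith [h1 M.xo]

/-- The derivative of `aroeMap` as a continuous linear equivalence. -/
noncomputable def aroeDerivEquiv (k : Xu × Xn → ℝ) : (Xu × Xn → ℝ) ≃L[ℝ] (Xu × Xn → ℝ) :=
  (LinearEquiv.ofInjectiveEndo (M.aroeDeriv k : (Xu × Xn → ℝ) →ₗ[ℝ] (Xu × Xn → ℝ))
    (M.aroeDeriv_injective k)).toContinuousLinearEquiv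

lemma coe_aroeDerivEquiv (k : Xu × Xn → ℝ) :
    (M.aroeDerivEquiv k : (Xu × Xn → ℝ) →L[ℝ] (Xu × Xn → ℝ)) = M.aroeDeriv k := rfl

/-- A priori bound for the optimality equation. Put `v = aroeMap k`. At the extrema of `k` one reads
off `|k(x°)| ≤ ‖v‖`;
Jensen's inequality `P₀ k ≤ Λ_k` then makes `k` superharmonic for `P₀` up to `2 ‖v‖`, which bounds
its oscillation because some power of `P₀` has positive entries. -/
lemma exists_norm_le_mul_norm_aroeMap : ∃ C : ℝ, 0 ≤ C ∧ ∀ k, ‖k‖ ≤ C * ‖M.aroeMap k‖ := by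
  have hne : Nonempty (Xu × Xn) := ⟨M.xo⟩
  obtain ⟨n, hn⟩ := M.irreducibleAperiodic.exists_pow_pos
  obtain ⟨z, hz⟩ := Finite.exists_min fun z : (Xu × Xn) × (Xu × Xn) => (M.P₀ ^ n) z.1 z.2
  set ε := (M.P₀ ^ n) z.1 z.2 with hε_def
  have hε : 0 < ε := hn z.1 z.2
  refine ⟨1 + n * 2 / ε, by positivity, fun k => ?_⟩
  set B := ‖M.aroeMap k‖ with hB_def
  have hB : ∀ x, |k x - M.logMGF k x + k M.xo| ≤ B := fun x => norm_le_pi_norm (M.aroeMap k) x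
  obtain ⟨x₀, hx₀⟩ := Finite.exists_min k
  obtain ⟨x₁, hx₁⟩ := Finite.exists_max k
  have hmin : k x₀ ≤ M.logMGF k x₀ := by
    rw [← M.logMGF_const (k x₀) x₀]
    exact M.logMGF_mono hx₀ x₀
  have hmax : M.logMGF k x₁ ≤ k x₁ := by
    conv_rhs => rw [← M.logMGF_const (k x₁) x₁]
    exact M.logMGF_mono hx₁ x₁
  have h0 := abs_le.1 (hB x₀)
  have h1 := abs_le.1 (hB x₁)
  have hsup : ∀ x, (M.P₀ *ᵥ k) x ≤ k x + 2 * B := by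
    intro x
    have h2 := M.logMGF_add_tilted_mulVec_sub_le k 0 x
    rw [logMGF_zero, tilted_zero, sub_zero, zero_add] at h2
    have h3 := abs_le.1 (hB x)
    linarith
  have hosc : ∀ y, k y - k x₀ ≤ n * 2 / ε * B := by
    intro y
    have h2 := pow_apply_mul_sub_le M.P₀_mem hsup hx₀ n y
    have h3 := mul_le_mul_of_nonneg_right (hz (x₀, y)) (sub_nonneg.2 (hx₀ y))
    rw [div_mul_eq_mul_div, le_div_iff₀ hε]
    linarith
  rw [pi_norm_le_iff_of_nonneg (by positivity)]
  intro y
  rw [Real.norm_eq_abs, abs_le]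
  constructor <;> linarith [hosc y, hosc M.xo, hx₀ y, hx₀ M.xo]

/-- The range is open by the inverse function theorem and closed by the a priori bound. -/
lemma aroeMap_surjective : Function.Surjective M.aroeMap := by
  have hopen : IsOpenMap M.aroeMap :=
    isOpenMap_of_hasStrictFDerivAt_equiv (f' := M.aroeDerivEquiv) M.hasStrictFDerivAt_aroeMap
  have hcont : Continuous M.aroeMap :=
    continuous_iff_continuousAt.2 fun k => (M.hasStrictFDerivAt_aroeMap k).continuousAt
  obtain ⟨C, hC0, hC⟩ := M.exists_norm_le_mul_norm_aroeMap
  have hproper : IsProperMap M.aroeMap := isProperMap_iff_tendsto_cocompact.2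
    ⟨hcont, Filter.tendsto_cocompact_cocompact_of_norm fun r => ⟨C * r, fun k hk =>
      lt_of_mul_lt_mul_left (hk.trans_le (hC k)) hC0⟩⟩
  rw [← Set.range_eq_univ]
  exact IsClopen.eq_univ ⟨hproper.isClosedMap.isClosed_range, hopen.isOpen_range⟩
    (Set.range_nonempty _)

/-! ### The ordinary differential equation -/

/-- The preimage of `ζ 𝒰` under `aroeMap`, normalized to vanish at `x°`. -/
noncomputable def valueCurve (ζ : ℝ) : Xu × Xn → ℝ :=
  fun x => Function.surjInv M.aroeMap_surjective (ζ • M.util) x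
    - Function.surjInv M.aroeMap_surjective (ζ • M.util) M.xo

/-- The derivative `k'` of the preimage `k` of `ζ 𝒰` satisfies `k' - P_k k' + k'(x°) = 𝒰`, which
is Poisson's equation. -/
lemma isODESolution_valueCurve : M.IsODESolution M.valueCurve := by
  set κ := Function.surjInv M.aroeMap_surjective with hκ
  have hright : ∀ v, M.aroeMap (κ v) = v := Function.surjInv_eq M.aroeMap_surjective
  have hleft : ∀ k, κ (M.aroeMap k) = k := fun k => M.aroeMap_injective (hright _)
  refine ⟨?_, fun ζ => ⟨M.tilted_isIrreducibleAperiodic _, ?_⟩⟩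
  · have h0 : κ ((0 : ℝ) • M.util) = 0 := M.aroeMap_injective <| by
      rw [hright]
      ext x
      simp [aroeMap, logMGF_zero]
    ext x
    simp only [valueCurve, ← hκ, h0, Pi.zero_apply, sub_self]
  · set k := κ (ζ • M.util) with hk
    set k' := (M.aroeDerivEquiv k).symm M.util with hk'
    have hκ' : HasDerivAt (fun ζ : ℝ => κ (ζ • M.util)) k' ζ := by
      have h1 : HasStrictFDerivAt M.aroeMap
          (M.aroeDerivEquiv k : (Xu × Xn → ℝ) →L[ℝ] (Xu × Xn → ℝ)) k :=
        M.hasStrictFDerivAt_aroeMap k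
      have h2 := (h1.to_local_left_inverse (.of_forall hleft)).hasFDerivAt
      rw [hk, hright] at h2
      have h3 : HasDerivAt (fun ζ : ℝ => ζ • M.util) M.util ζ := by
        simpa using (hasDerivAt_id ζ).smul_const M.util
      exact h2.comp_hasDerivAt ζ h3
    have hval : HasDerivAt M.valueCurve (fun x => k' x - k' M.xo) ζ := by
      rw [hasDerivAt_pi] at hκ' ⊢
      exact fun x => (hκ' x).sub (hκ' M.xo)
    have heq : ∀ x, k' x - (M.tilted k *ᵥ k') x + k' M.xo = M.util x := fun x => by
      rw [← aroeDeriv_apply, ← coe_aroeDerivEquiv]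
      exact congrFun ((M.aroeDerivEquiv k).apply_symm_apply M.util) x
    have htilt : M.tilted (M.valueCurve ζ) = M.tilted k := M.tilted_add_const k (-k M.xo)
    convert hval using 1
    rw [vectorField, htilt]
    refine (eq_poissonSolution (M.tilted_mem k) (M.tilted_isIrreducibleAperiodic k)
      (H := fun x => k' x - k' M.xo) (c := k' M.xo) (sub_self _) fun x => ?_).symm
    have h4 : (M.tilted k *ᵥ fun x => k' x - k' M.xo) x = (M.tilted k *ᵥ k') x - k' M.xo := by
      simp only [mulVec, dotProduct, mul_sub, Finset.sum_sub_distrib, ← Finset.sum_mul,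
        sum_row_of_mem_rowStochastic (M.tilted_mem k), one_mul]
    rw [h4]
    linarith [heq x]

variable {M}

lemma IsODESolution.apply_xo {h : ℝ → Xu × Xn → ℝ} (hh : M.IsODESolution h) (ζ : ℝ) :
    h ζ M.xo = 0 := by
  have hd : ∀ t, HasDerivAt (fun t => h t M.xo) 0 t := fun t => by
    have := hasDerivAt_pi.1 (hh.2 t).2 M.xo
    rwa [vectorField, poissonSolution_apply_self] at this
  have := is_const_of_deriv_eq_zero (fun t => (hd t).differentiableAt) (fun t => (hd t).deriv) ζ 0
  simpa [hh.1] using this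

/-- Along a solution of the differential equation the derivative of `Λ_h + ζ 𝒰 - h` is
`P_h H + 𝒰 - H` for a solution `H` of Poisson's equation, hence the same at every state. Since
`Λ_h + ζ 𝒰 - h` vanishes at `ζ = 0`, it is constant in the state for every `ζ`. -/
lemma IsODESolution.aroe {h : ℝ → Xu × Xn → ℝ} (hh : M.IsODESolution h) (ζ : ℝ) :
    ∃ η : ℝ, ∀ x, M.logMGF (h ζ) x + ζ * M.util x = h ζ x + η := by
  set f : Xu × Xn → ℝ → ℝ := fun x t => M.logMGF (h t) x + t * M.util x - h t x with hf
  have hder : ∀ t, ∃ c, ∀ x, HasDerivAt (f x) c t := by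
    intro t
    obtain ⟨c, hc⟩ := exists_poissonSolution_sub_mulVec (M.tilted_mem (h t)) (hh.2 t).1 M.util M.xo
    refine ⟨c, fun x => ?_⟩
    have h1 := hasDerivAt_pi.1
      ((M.hasStrictFDerivAt_logMGF (h t)).hasFDerivAt.comp_hasDerivAt t (hh.2 t).2) x
    have h2 := hasDerivAt_pi.1 (hh.2 t).2 x
    have h3 := (h1.add ((hasDerivAt_id t).mul_const (M.util x))).sub h2
    refine h3.congr_deriv ?_
    have h4 := hc x
    rw [LinearMap.coe_toContinuousLinearMap', mulVecLin_apply, vectorField]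
    linarith
  refine ⟨f M.xo ζ, fun x => ?_⟩
  have hd : ∀ t, HasDerivAt (fun t => f x t - f M.xo t) 0 t := fun t => by
    obtain ⟨c, hc⟩ := hder t
    exact ((hc x).sub (hc M.xo)).congr_deriv (sub_self c)
  have h0 := is_const_of_deriv_eq_zero (fun t => (hd t).differentiableAt)
    (fun t => (hd t).deriv) ζ 0
  simp only [hf, hh.1, logMGF_zero, Pi.zero_apply] at h0 ⊢
  linarith

lemma IsODESolution.isRelativeValueFunction_iff {h : ℝ → Xu × Xn → ℝ} (hh : M.IsODESolution h)
    (ζ : ℝ) (g : Xu × Xn → ℝ) : M.IsRelativeValueFunction ζ g ↔ g = h ζ := by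
  obtain ⟨η, hη⟩ := hh.aroe ζ
  constructor
  · rintro ⟨hg0, η', -, hg⟩
    have heq := M.aroeMap_injective <| (M.aroeMap_add_const hg0 (M.solvesAROE_iff.1 hg)).trans
      (M.aroeMap_add_const (hh.apply_xo ζ) hη).symm
    have hη' : η' = η := by simpa [hg0, hh.apply_xo ζ] using congrFun heq M.xo
    ext x
    simpa [hη'] using congrFun heq x
  · rintro rfl
    exact ⟨hh.apply_xo ζ, η, M.isOptimalReward hη, M.solvesAROE_iff.2 hη⟩

end Model

end KLMDP

theorem theoremt {Xu Xn : Type*} [Fintype Xu] [Fintype Xn] [DecidableEq Xu] [DecidableEq Xn]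
    (M : KLMDP.Model Xu Xn) :
    (∃ h : ℝ → Xu × Xn → ℝ, M.IsODESolution h) ∧
    ∀ h : ℝ → Xu × Xn → ℝ, M.IsODESolution h →
      (∀ (ζ : ℝ) (g : Xu × Xn → ℝ), M.IsRelativeValueFunction ζ g ↔ g = h ζ) ∧
      (∀ (ζ : ℝ) (P : Matrix (Xu × Xn) (Xu × Xn) ℝ),
        M.IsOptimalTransition ζ P ↔ P = M.tilted (h ζ)) := by
  refine ⟨⟨M.valueCurve, M.isODESolution_valueCurve⟩, fun h hh =>
    ⟨hh.isRelativeValueFunction_iff, fun ζ P => ?_⟩⟩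
  obtain ⟨η, hη⟩ := hh.aroe ζ
  exact M.isOptimalTransition_iff hη P
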